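/- Let $\lambda_c\in(0,1/128)$ and set $f_c=1/\lambda_c$. Let $v_1<v_2<\dots<v_n$ be points of $[0,1)$, regarded as points of the circle $\mathbb T=\mathbb R/\mathbb Z$, and assume that every closed arc of $\mathbb T$ of length $1.87\,\lambda_c$ contains at most one of them. Let $f_1,\dots,f_n$ and $d_1,\dots,d_n$ be real numbers with $|f_j|\le 1$ and $|d_j|\le 1/\lambda_c$ for all $j$. Then there is a real-valued trigonometric polynomial $q$ with the following properties. 1. $q$ is frequency-limited to $f_c$: $q(t)=\sum_{k\in\mathbb Z,\ |k|\le f_c}\hat q_k\,e^{-2\pi i k t}$ for some $\hat q_k\in\mathbb C$ and all $t\in\mathbb R$. 2. $q(v_j)=f_j$ and $q'(v_j)=d_j$ for all $j=1,\dots,n$. 3. $\|q\|_\infty\le c_{u0}$. 4. $\|q'\|_\infty\le c_{u1}/\lambda_c$. 5. $\|q''\|_\infty\le c_{u2}/\lambda_c^2$. Here $c_{u0},c_{u1},c_{u2}$ are the positive numerical constants $$c_{u0}=2.22\,(1.009+1.008\cdot 0.08\cdot 0.47)+38.2\,(0.43\cdot 0.08\cdot 1.009+0.47)\approx 21.6,\qquad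 c_{u1}=2\pi c_{u0},\qquad c_{u2}=4\pi^2c_{u0}.$$ -/

import Mathlib

/-- The closed arc of the circle `ℝ/ℤ` that starts at the class of `a` and has length `d`. -/
def circleArc (a d : ℝ) : Set UnitAddCircle :=
  (fun x : ℝ => (x : UnitAddCircle)) '' Set.Icc a (a + d)

/-- Rayleigh regularity with parameters `(d, r)`: the set `S` is the union of `r` pairwise
disjoint sets, each of which has at most one point in every arc of length `d`. -/
def RayleighRegular (d : ℝ) (r : ℕ) (S : Set UnitAddCircle) : Prop :=
  ∃ P : Fin r → Set UnitAddCircle,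
    S = ⋃ i, P i ∧
    (∀ i j, i < j → Disjoint (P i) (P j)) ∧
    ∀ i, ∀ a : ℝ, (P i ∩ circleArc a d).encard ≤ 1

/-- The real-valued function `q` is a trigonometric polynomial frequency-limited to `fc`:
only the integer frequencies `k` with `-fc ≤ k ≤ fc` occur. -/
def IsTrigPoly (fc : ℝ) (q : ℝ → ℝ) : Prop :=
  ∃ a : ℤ → ℂ, ∀ t : ℝ,
    (q t : ℂ) = ∑ k ∈ Finset.Icc (-⌊fc⌋) ⌊fc⌋,
      a k * Complex.exp (-(2 * Real.pi * Complex.I * k * t))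

/-- `c_α = c_{F⁻¹} + c_{D₀⁻¹} c_{D₁} c_{E⁻¹}`. -/
noncomputable def cAlpha : ℝ := 1.009 + 1.008 * 0.08 * 0.47

/-- `c_β = c_{D₂⁻¹} c_{D₁} c_{F⁻¹} + c_{E⁻¹}`. -/
noncomputable def cBeta : ℝ := 0.43 * 0.08 * 1.009 + 0.47

/-- The numerical constant in the bound for `q` (about `21.6`). -/
noncomputable def cU0 : ℝ := cAlpha * 2.22 + cBeta * 38.2

/-- The numerical constant in the bound for `q'`. -/
noncomputable def cU1 : ℝ := 2 * Real.pi * cU0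

/-- The numerical constant in the bound for `q''`. -/
noncomputable def cU2 : ℝ := 4 * Real.pi ^ 2 * cU0

/-!
The polynomial is sought in the form `q = ∑ j, (α j * K (t - v j) + β j * H (t - v j))`, where, with
`D` the normalized Dirichlet kernel `sin (πMt) / (M sin (πt))`, `K = D ^ 4` is Jackson's kernel and
`H = M * D ^ 4 * sin (2πt) / (2π)`. Near `0` these behave like the constant `1` and like `M * t`, so
`K` carries the values and `H` the derivatives. They have degree at most `2M - 1`, and `M` is chosen
largest with `2M - 1 ≤ 1 / lam`. Then `M * lam > 127 / 256`, and the points are separated by more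
than `0.927 / M`.

With `u = 1 / (M |sin (πt)|)` one has `|K| ≤ u ^ 4`, `|H| ≤ u ^ 3 / π`,
`|K'| ≤ 4πM u ^ 4 (1 + u)` and `|H'| ≤ M (4 u ^ 3 + 5 u ^ 4)`. From `x ≤ tan x` one gets
`1 / sin x ^ 2 ≤ 1 / x ^ 2 + 1`; cutting the circle into cells of length `0.927 / M`, each of which
holds at most one point, and using `∑ 1 / k ^ 2 = π ^ 2 / 6`, one bounds `∑ u ^ 2` over all points
that are not in the two cells next to `t` (`sum_cscBound_sq_le`). Hence the off-diagonal row sums of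
the interpolation conditions are at most `0.048`, `0.0445`, `0.811` and `0.799`, the linear system
for `α` and `β` is solvable (`exists_solution_coupledSystem`) with `|α j| ≤ 1.9` and
`|β j| ≤ 17.7`, and `|q|` is at most `16`, which is below `cU0` (`exists_kernelCombination`).

The bounds on `q'` and `q''` follow from Bernstein's inequality `‖q'‖ ≤ 2π fc ‖q‖`
(`IsTrigPoly.abs_deriv_le`), which comes from a Riesz type interpolation formula: on the frequencies
`|k| ≤ fc` the multiplier `k` agrees with a triangle wave, whose Fourier coefficients have absolute
sum equal to its maximum.
-/

open Finset

/-! ### Bernstein's inequality -/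

theorem hasSum_cos_div_sq {x : ℝ} (hx : x ∈ Set.Icc (0 : ℝ) 1) :
    HasSum (fun n : ℕ => 1 / (n : ℝ) ^ 2 * Real.cos (2 * Real.pi * n * x))
      (Real.pi ^ 2 * (x ^ 2 - x + 1 / 6)) := by
  have h := hasSum_one_div_nat_pow_mul_cos one_ne_zero hx
  rw [mul_one] at h
  convert h using 1
  have e : (Polynomial.map (algebraMap ℚ ℝ) (Polynomial.bernoulli 2)).eval x
      = x ^ 2 - x + 1 / 6 := by
    simp [Polynomial.bernoulli, Finset.sum_range_succ, Polynomial.eval_add, bernoulli_two,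
      bernoulli_one]
    ring
  rw [e]
  norm_num only [Nat.factorial]
  ring

/-- The odd part of `hasSum_cos_div_sq`; the even part is a quarter of the same series at `2x`. -/
theorem hasSum_cos_odd_div_sq {x : ℝ} (hx : x ∈ Set.Icc (0 : ℝ) (1 / 2)) :
    HasSum (fun m : ℕ => 1 / (2 * m + 1 : ℝ) ^ 2 * Real.cos (2 * Real.pi * (2 * m + 1) * x))
      (Real.pi ^ 2 * (1 / 8 - x / 2)) := by
  set F : ℕ → ℝ := fun n => 1 / (n : ℝ) ^ 2 * Real.cos (2 * Real.pi * n * x) with hF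
  have hall : HasSum F _ := hasSum_cos_div_sq ⟨hx.1, by linarith [hx.2]⟩
  have heven : HasSum (fun m : ℕ => F (2 * m))
      (1 / 4 * (Real.pi ^ 2 * ((2 * x) ^ 2 - 2 * x + 1 / 6))) := by
    have h := (hasSum_cos_div_sq (x := 2 * x)
      ⟨by linarith [hx.1], by linarith [hx.2]⟩).mul_left (1 / 4)
    refine h.congr_fun fun m => ?_
    simp only [hF]
    push_cast
    rw [show 2 * Real.pi * (2 * (m : ℝ)) * x = 2 * Real.pi * m * (2 * x) by ring, mul_pow]
    ring
  have hodd : Summable fun m : ℕ => F (2 * m + 1) :=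
    hall.summable.comp_injective fun a b h => by simpa using h
  have htot := (heven.even_add_odd hodd.hasSum).unique hall
  have hval : ∑' m : ℕ, F (2 * m + 1) = Real.pi ^ 2 * (1 / 8 - x / 2) := by linarith
  have h := hodd.hasSum
  rw [hval] at h
  convert h using 1
  ext m
  simp [hF]

/-- The Fourier series of the triangle wave, on the interval where the wave is linear. -/
theorem hasSum_triangle_wave {θ : ℝ} (hθ : |θ| ≤ Real.pi / 2) :
    HasSum (fun m : ℕ => (-1 : ℝ) ^ m / (2 * m + 1) ^ 2 * Real.sin ((2 * m + 1) * θ))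
      (Real.pi * θ / 4) := by
  have hpi := Real.pi_pos
  obtain ⟨h1, h2⟩ := abs_le.1 hθ
  have hx : 1 / 4 - θ / (2 * Real.pi) ∈ Set.Icc (0 : ℝ) (1 / 2) := by
    have e : θ / (2 * Real.pi) * (2 * Real.pi) = θ := by field_simp
    constructor <;> nlinarith
  convert hasSum_cos_odd_div_sq hx using 1
  · ext m
    have e : 2 * Real.pi * (2 * m + 1) * (1 / 4 - θ / (2 * Real.pi))
        = (Real.pi / 2 - (2 * m + 1) * θ) + m * Real.pi := by field_simp; ring
    rw [e, Real.cos_add_nat_mul_pi, Real.cos_pi_div_two_sub]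
    ring
  · field_simp
    ring

theorem hasSum_one_div_odd_sq :
    HasSum (fun m : ℕ => 1 / (2 * m + 1 : ℝ) ^ 2) (Real.pi ^ 2 / 8) := by
  convert hasSum_cos_odd_div_sq (x := 0) ⟨le_rfl, by norm_num⟩ using 1
  · simp
  · ring

theorem hasDerivAt_sum_exp (S : Finset ℤ) (a : ℤ → ℂ) (t : ℝ) :
    HasDerivAt (fun s : ℝ => ∑ k ∈ S, a k * Complex.exp (-(2 * Real.pi * Complex.I * k * s)))
      (∑ k ∈ S, (a k * -(2 * Real.pi * Complex.I * k)) *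
        Complex.exp (-(2 * Real.pi * Complex.I * k * t))) t := by
  refine HasDerivAt.fun_sum fun k _ => ?_
  have h1 : HasDerivAt (fun s : ℝ => -(2 * Real.pi * Complex.I * k * (s : ℂ)))
      (-(2 * Real.pi * Complex.I * k * 1)) t :=
    ((Complex.ofRealCLM.hasDerivAt (x := t)).const_mul (2 * Real.pi * Complex.I * k)).fun_neg
  refine (h1.cexp.const_mul (a k)).congr_deriv ?_
  ring

theorem IsTrigPoly.differentiable {fc : ℝ} {q : ℝ → ℝ} (hq : IsTrigPoly fc q) :
    Differentiable ℝ q := by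
  obtain ⟨a, ha⟩ := hq
  intro t
  have h := (hasDerivAt_sum_exp (Icc (-⌊fc⌋) ⌊fc⌋) a t).congr_of_eventuallyEq
    (Filter.Eventually.of_forall ha)
  have h' : HasDerivAt (fun s : ℝ => (q s : ℂ).re) _ t :=
    Complex.reCLM.hasFDerivAt.comp_hasDerivAt t h
  simp only [Complex.ofReal_re] at h'
  exact h'.differentiableAt

theorem deriv_eq_sum_exp {q : ℝ → ℝ} (hq : Differentiable ℝ q) {S : Finset ℤ} {a : ℤ → ℂ}
    (ha : ∀ t : ℝ, (q t : ℂ) =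
      ∑ k ∈ S, a k * Complex.exp (-(2 * Real.pi * Complex.I * k * t))) (t : ℝ) :
    ((deriv q t : ℝ) : ℂ) = ∑ k ∈ S, (a k * -(2 * Real.pi * Complex.I * k)) *
      Complex.exp (-(2 * Real.pi * Complex.I * k * t)) :=
  (hq t).hasDerivAt.ofReal_comp.unique
    ((hasDerivAt_sum_exp S a t).congr_of_eventuallyEq (Filter.Eventually.of_forall ha))

theorem IsTrigPoly.deriv {fc : ℝ} {q : ℝ → ℝ} (hq : IsTrigPoly fc q) :
    IsTrigPoly fc (_root_.deriv q) := by
  have hd := hq.differentiable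
  obtain ⟨a, ha⟩ := hq
  exact ⟨_, deriv_eq_sum_exp hd ha⟩

/-- An interpolation formula of M. Riesz type: on frequencies `|k| ≤ fc` the multiplier of the
derivative agrees with a triangle wave, whose Fourier series supplies nodes and weights. -/
theorem IsTrigPoly.hasSum_deriv {fc : ℝ} (hfc : 0 < fc) {q : ℝ → ℝ} (hq : IsTrigPoly fc q)
    (t : ℝ) :
    HasSum (fun m : ℕ => (-1 : ℝ) ^ m / (2 * m + 1) ^ 2 *
        (q (t + (2 * m + 1) / (4 * fc)) - q (t - (2 * m + 1) / (4 * fc))))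
      (Real.pi / (8 * fc) * _root_.deriv q t) := by
  have hpi := Real.pi_pos
  have hd := hq.differentiable
  obtain ⟨a, ha⟩ := hq
  rw [← Complex.hasSum_ofReal]
  have hk : ∀ k ∈ Icc (-⌊fc⌋) ⌊fc⌋, HasSum (fun m : ℕ =>
      (((-1 : ℝ) ^ m / (2 * m + 1) ^ 2 *
          Real.sin ((2 * m + 1) * (Real.pi * k / (2 * fc))) : ℝ) : ℂ)
        * (a k * (-2 * Complex.I) * Complex.exp (-(2 * Real.pi * Complex.I * k * t))))
      (((Real.pi * (Real.pi * k / (2 * fc)) / 4 : ℝ) : ℂ)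
        * (a k * (-2 * Complex.I) * Complex.exp (-(2 * Real.pi * Complex.I * k * t)))) := by
    intro k hk
    refine (Complex.hasSum_ofReal.2 (hasSum_triangle_wave ?_)).mul_right _
    have hkf : |(k : ℝ)| ≤ fc := by
      rw [mem_Icc] at hk
      have h1 : ((-⌊fc⌋ : ℤ) : ℝ) ≤ k := Int.cast_le.2 hk.1
      have h2 : (k : ℝ) ≤ (⌊fc⌋ : ℤ) := Int.cast_le.2 hk.2
      push_cast at h1
      exact abs_le.2 ⟨by linarith [Int.floor_le fc], by linarith [Int.floor_le fc]⟩
    rw [abs_div, abs_mul, abs_of_pos hpi, abs_of_pos (by positivity : 0 < 2 * fc),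
      div_le_div_iff₀ (by positivity) (by positivity)]
    nlinarith
  convert hasSum_sum hk using 1
  · ext m
    push_cast
    rw [ha, ha, ← sum_sub_distrib, mul_sum]
    refine sum_congr rfl fun k _ => ?_
    -- `exp (-ix) - exp (ix) = -2i sin x` at `x = 2πkτ`, where `τ` is the node.
    rw [Complex.sin]
    have e : ∀ z w : ℂ, Complex.exp (-(2 * Real.pi * Complex.I * k * (z + w)))
        = Complex.exp (-(2 * Real.pi * Complex.I * k * z))
          * Complex.exp (-(2 * Real.pi * k * w) * Complex.I) := by
      intro z w
      rw [← Complex.exp_add]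
      ring_nf
    have hfc' : (fc : ℂ) ≠ 0 := by exact_mod_cast hfc.ne'
    have e1 : (2 * (m : ℂ) + 1) * (Real.pi * k / (2 * fc))
        = 2 * Real.pi * k * ((2 * m + 1) / (4 * fc)) := by
      field_simp
      ring
    push_cast
    rw [sub_eq_add_neg (t : ℂ), e, e, e1, mul_neg, neg_neg]
    linear_combination (-1 : ℂ) ^ m / (2 * m + 1) ^ 2 * a k
      * Complex.exp (-(2 * Real.pi * Complex.I * k * t))
      * (Complex.exp (-(2 * Real.pi * k * ((2 * m + 1) / (4 * fc))) * Complex.I)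
        - Complex.exp (2 * Real.pi * k * ((2 * m + 1) / (4 * fc)) * Complex.I)) * Complex.I_sq
  · push_cast
    rw [deriv_eq_sum_exp hd ha, mul_sum]
    refine sum_congr rfl fun k _ => ?_
    have hfc' : (fc : ℂ) ≠ 0 := by exact_mod_cast hfc.ne'
    field_simp
    ring

/-- **Bernstein's inequality**, with the sharp constant. -/
theorem IsTrigPoly.abs_deriv_le {fc : ℝ} (hfc : 0 < fc) {q : ℝ → ℝ} (hq : IsTrigPoly fc q)
    {C : ℝ} (hC : ∀ t, |q t| ≤ C) (t : ℝ) : |_root_.deriv q t| ≤ 2 * Real.pi * fc * C := by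
  have hpi := Real.pi_pos
  have h := hq.hasSum_deriv hfc t
  have hb := hasSum_one_div_odd_sq.mul_right (2 * C)
  have hle : |Real.pi / (8 * fc) * _root_.deriv q t| ≤ Real.pi ^ 2 / 8 * (2 * C) := by
    rw [← h.tsum_eq, ← hb.tsum_eq, ← Real.norm_eq_abs]
    refine tsum_of_norm_bounded hb.summable.hasSum fun m => ?_
    rw [norm_mul, norm_div, norm_pow, norm_neg, norm_one, one_pow, Real.norm_eq_abs,
      Real.norm_eq_abs, abs_of_nonneg (by positivity : (0 : ℝ) ≤ (2 * m + 1) ^ 2)]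
    gcongr
    calc _ ≤ |q (t + (2 * m + 1) / (4 * fc))| + |q (t - (2 * m + 1) / (4 * fc))| := abs_sub _ _
      _ ≤ 2 * C := by linarith [hC (t + (2 * m + 1) / (4 * fc)), hC (t - (2 * m + 1) / (4 * fc))]
  rw [abs_mul, abs_of_pos (by positivity)] at hle
  have e : |_root_.deriv q t| = 8 * fc / Real.pi * (Real.pi / (8 * fc) * |_root_.deriv q t|) := by
    field_simp
  rw [e]
  calc _ ≤ 8 * fc / Real.pi * (Real.pi ^ 2 / 8 * (2 * C)) := by gcongr
    _ = _ := by field_simp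

/-! ### The space of trigonometric polynomials -/

/-- The exponential `t ↦ exp (-2πikt)`. -/
noncomputable def trigExp (k : ℤ) (t : ℝ) : ℂ :=
  Complex.exp (-(2 * Real.pi * Complex.I * k * t))

/-- The complex trigonometric polynomials of degree at most `N`. -/
noncomputable def trigSpan (N : ℤ) : Submodule ℂ (ℝ → ℂ) :=
  Submodule.span ℂ (trigExp '' ↑(Icc (-N) N))

theorem trigExp_mem {N k : ℤ} (h1 : -N ≤ k) (h2 : k ≤ N) : trigExp k ∈ trigSpan N :=
  Submodule.subset_span ⟨k, by simp [h1, h2], rfl⟩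

theorem trigExp_mul (j k : ℤ) : trigExp j * trigExp k = trigExp (j + k) := by
  ext t
  simp only [trigExp, Pi.mul_apply, ← Complex.exp_add]
  push_cast
  ring_nf

theorem mul_mem_trigSpan {N N' : ℤ} {f g : ℝ → ℂ} (hf : f ∈ trigSpan N) (hg : g ∈ trigSpan N') :
    f * g ∈ trigSpan (N + N') := by
  have h : f * g ∈ trigSpan N * trigSpan N' := Submodule.mul_mem_mul hf hg
  rw [trigSpan, trigSpan, Submodule.span_mul_span] at h
  refine Submodule.span_mono ?_ h
  rintro _ ⟨_, ⟨j, hj, rfl⟩, _, ⟨k, hk, rfl⟩, rfl⟩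
  simp only [coe_Icc, Set.mem_Icc] at hj hk
  refine ⟨j + k, ?_, (trigExp_mul j k).symm⟩
  simp only [coe_Icc, Set.mem_Icc]
  omega

theorem trigSpan_mono {N N' : ℤ} (h : N ≤ N') : trigSpan N ≤ trigSpan N' := by
  refine Submodule.span_mono (Set.image_mono ?_)
  intro k hk
  simp only [coe_Icc, Set.mem_Icc] at hk ⊢
  omega

theorem comp_sub_mem_trigSpan {N : ℤ} {f : ℝ → ℂ} (hf : f ∈ trigSpan N) (v : ℝ) :
    (fun t => f (t - v)) ∈ trigSpan N := by
  induction hf using Submodule.span_induction with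
  | mem x hx =>
    obtain ⟨k, hk, rfl⟩ := hx
    have e : (fun t => trigExp k (t - v)) = trigExp k (-v) • trigExp k := by
      ext t
      simp only [trigExp, Pi.smul_apply, smul_eq_mul, ← Complex.exp_add]
      push_cast
      ring_nf
    rw [e]
    exact Submodule.smul_mem _ _ (Submodule.subset_span ⟨k, hk, rfl⟩)
  | zero => exact Submodule.zero_mem _
  | add x y _ _ hx hy => exact Submodule.add_mem _ hx hy
  | smul a x _ hx => exact Submodule.smul_mem _ a hx

theorem isTrigPoly_of_mem_trigSpan {fc : ℝ} {q : ℝ → ℝ}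
    (h : (fun t => (q t : ℂ)) ∈ trigSpan ⌊fc⌋) : IsTrigPoly fc q := by
  obtain ⟨a, ha⟩ := (Submodule.mem_span_image_finset_iff_exists_fun ℂ).1 h
  refine ⟨fun k => if hk : k ∈ Icc (-⌊fc⌋) ⌊fc⌋ then a ⟨k, hk⟩ else 0, fun t => ?_⟩
  rw [← congrFun ha t, Finset.sum_apply, ← Finset.sum_coe_sort (Icc (-⌊fc⌋) ⌊fc⌋)]
  refine sum_congr rfl fun k _ => ?_
  simp only [Pi.smul_apply, smul_eq_mul, trigExp, k.2, dite_true, Subtype.coe_eta]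

theorem cos_mem_trigSpan {N k : ℤ} (h : |k| ≤ N) :
    (fun t : ℝ => ((Real.cos (2 * Real.pi * k * t) : ℝ) : ℂ)) ∈ trigSpan N := by
  obtain ⟨h1, h2⟩ := abs_le.1 h
  have e : (fun t : ℝ => ((Real.cos (2 * Real.pi * k * t) : ℝ) : ℂ))
      = (1 / 2 : ℂ) • (trigExp k + trigExp (-k)) := by
    ext t
    simp only [trigExp, Pi.smul_apply, Pi.add_apply, smul_eq_mul]
    push_cast
    rw [Complex.cos]
    ring_nf
  rw [e]
  exact Submodule.smul_mem _ _ (Submodule.add_mem _ (trigExp_mem h1 h2)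
    (trigExp_mem (by omega) (by omega)))

theorem sin_mem_trigSpan {N k : ℤ} (h : |k| ≤ N) :
    (fun t : ℝ => ((Real.sin (2 * Real.pi * k * t) : ℝ) : ℂ)) ∈ trigSpan N := by
  obtain ⟨h1, h2⟩ := abs_le.1 h
  have e : (fun t : ℝ => ((Real.sin (2 * Real.pi * k * t) : ℝ) : ℂ))
      = (Complex.I / 2 : ℂ) • (trigExp k - trigExp (-k)) := by
    ext t
    simp only [trigExp, Pi.smul_apply, Pi.sub_apply, smul_eq_mul]
    push_cast
    rw [Complex.sin]
    ring_nf
  rw [e]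
  exact Submodule.smul_mem _ _ (Submodule.sub_mem _ (trigExp_mem h1 h2)
    (trigExp_mem (by omega) (by omega)))

/-! ### The interpolation kernels -/

/-- The normalized Dirichlet kernel `sin (πMt) / (M sin (πt))`, written as a sum of cosines so that
it is visibly smooth. For even `M` its frequencies are half-integers. -/
noncomputable def dirichlet (M : ℕ) (t : ℝ) : ℝ :=
  (∑ k ∈ range M, Real.cos (Real.pi * (2 * k + 1 - M) * t)) / M

/-- Jackson's kernel, the square of the normalized Fejér kernel. It carries the values. -/
noncomputable def valueKernel (M : ℕ) (t : ℝ) : ℝ := dirichlet M t ^ 4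

/-- The kernel that carries the derivatives: it vanishes at `0`, where its derivative is `M`. -/
noncomputable def slopeKernel (M : ℕ) (t : ℝ) : ℝ :=
  M / (2 * Real.pi) * (dirichlet M t ^ 4 * Real.sin (2 * Real.pi * t))

/-- The closed form of the Dirichlet kernel, without division by `sin (πt)`. -/
theorem mul_sin_mul_dirichlet {M : ℕ} (hM : M ≠ 0) (t : ℝ) :
    M * Real.sin (Real.pi * t) * dirichlet M t = Real.sin (M * (Real.pi * t)) := by
  have hM' : (M : ℝ) ≠ 0 := Nat.cast_ne_zero.2 hM
  -- The sum telescopes: `2 sin a cos b = sin (b + a) - sin (b - a)`.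
  have key : ∀ m : ℕ, 2 * Real.sin (Real.pi * t) *
      ∑ k ∈ range m, Real.cos (Real.pi * (2 * k + 1 - M) * t)
      = Real.sin (Real.pi * (2 * m - M) * t) + Real.sin (M * (Real.pi * t)) := by
    intro m
    induction m with
    | zero =>
      rw [show Real.pi * (2 * ((0 : ℕ) : ℝ) - M) * t = -(M * (Real.pi * t)) by push_cast; ring,
        Real.sin_neg]
      simp
    | succ m ih =>
      rw [sum_range_succ, mul_add, ih]
      have e1 : Real.pi * (2 * ((m + 1 : ℕ) : ℝ) - M) * t
          = Real.pi * (2 * m + 1 - M) * t + Real.pi * t := by push_cast; ring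
      have e2 : Real.pi * (2 * (m : ℝ) - M) * t
          = Real.pi * (2 * m + 1 - M) * t - Real.pi * t := by ring
      rw [e1, e2, Real.sin_add, Real.sin_sub]
      ring
  have h := key M
  rw [show Real.pi * (2 * (M : ℝ) - M) * t = M * (Real.pi * t) by ring] at h
  rw [dirichlet, mul_assoc, mul_div_assoc', mul_div_cancel₀ _ hM']
  linarith

theorem dirichlet_zero {M : ℕ} (hM : M ≠ 0) : dirichlet M 0 = 1 := by
  have hM' : (M : ℝ) ≠ 0 := Nat.cast_ne_zero.2 hM
  simp [dirichlet, hM']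

theorem abs_dirichlet_le_one (M : ℕ) (t : ℝ) : |dirichlet M t| ≤ 1 := by
  rw [dirichlet, abs_div, Nat.abs_cast]
  refine div_le_one_of_le₀ ?_ (Nat.cast_nonneg M)
  refine (abs_sum_le_sum_abs _ _).trans ((sum_le_sum fun k _ => Real.abs_cos_le_one _).trans ?_)
  simp

theorem differentiable_dirichlet (M : ℕ) : Differentiable ℝ (dirichlet M) := by
  unfold dirichlet
  fun_prop

theorem deriv_dirichlet_zero (M : ℕ) : deriv (dirichlet M) 0 = 0 := by
  have heven : (fun t => dirichlet M (-t)) = dirichlet M := by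
    ext t
    simp only [dirichlet, mul_neg, Real.cos_neg]
  have h := deriv_comp_neg (dirichlet M) 0
  rw [heven, neg_zero] at h
  linarith

/-- The derivative of the identity `mul_sin_mul_dirichlet`, divided by `M`. -/
theorem sin_mul_deriv_dirichlet {M : ℕ} (hM : M ≠ 0) (t : ℝ) :
    Real.sin (Real.pi * t) * deriv (dirichlet M) t
      = Real.pi * (Real.cos (M * (Real.pi * t)) - Real.cos (Real.pi * t) * dirichlet M t) := by
  have hM' : (M : ℝ) ≠ 0 := Nat.cast_ne_zero.2 hM
  have hpt : HasDerivAt (fun s : ℝ => Real.pi * s) Real.pi t := by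
    simpa using (hasDerivAt_id t).const_mul Real.pi
  have h1 := (hpt.sin.const_mul (M : ℝ)).mul (differentiable_dirichlet M t).hasDerivAt
  have h2 := (hpt.const_mul (M : ℝ)).sin
  have e : ((fun s => (M : ℝ) * Real.sin (Real.pi * s)) * dirichlet M)
      = fun s => Real.sin (M * (Real.pi * s)) := by
    ext s
    exact mul_sin_mul_dirichlet hM s
  rw [e] at h1
  have h := h1.unique h2
  apply mul_left_cancel₀ hM'
  linear_combination h

/-- The reciprocal of `M |sin (πt)|`, which controls the decay of both kernels. -/
noncomputable def cscBound (M : ℕ) (t : ℝ) : ℝ := 1 / (M * |Real.sin (Real.pi * t)|)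

theorem cscBound_nonneg (M : ℕ) (t : ℝ) : 0 ≤ cscBound M t := by
  unfold cscBound
  positivity

theorem abs_dirichlet_le {M : ℕ} (hM : M ≠ 0) {t : ℝ} (ht : Real.sin (Real.pi * t) ≠ 0) :
    |dirichlet M t| ≤ cscBound M t := by
  have hM' : 0 < (M : ℝ) := Nat.cast_pos.2 (Nat.pos_of_ne_zero hM)
  have hs := abs_pos.2 ht
  have h := congrArg abs (mul_sin_mul_dirichlet hM t)
  rw [abs_mul, abs_mul, Nat.abs_cast] at h
  rw [cscBound, le_div_iff₀ (by positivity)]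
  linarith [Real.abs_sin_le_one (M * (Real.pi * t))]

theorem abs_sin_mul_deriv_dirichlet_le {M : ℕ} (hM : M ≠ 0) {t : ℝ}
    (ht : Real.sin (Real.pi * t) ≠ 0) :
    |Real.sin (Real.pi * t)| * |deriv (dirichlet M) t| ≤ Real.pi * (1 + cscBound M t) := by
  rw [← abs_mul, sin_mul_deriv_dirichlet hM, abs_mul, abs_of_pos Real.pi_pos]
  have h1 := Real.abs_cos_le_one (M * (Real.pi * t))
  have h2 : |Real.cos (Real.pi * t) * dirichlet M t| ≤ 1 * cscBound M t := by
    rw [abs_mul]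
    exact mul_le_mul (Real.abs_cos_le_one _) (abs_dirichlet_le hM ht) (abs_nonneg _) zero_le_one
  have := abs_sub (Real.cos (M * (Real.pi * t))) (Real.cos (Real.pi * t) * dirichlet M t)
  have hpi := Real.pi_pos
  gcongr
  linarith

theorem abs_deriv_dirichlet_le {M : ℕ} (hM : M ≠ 0) {t : ℝ} (ht : Real.sin (Real.pi * t) ≠ 0) :
    |deriv (dirichlet M) t| ≤ M * (Real.pi * cscBound M t * (1 + cscBound M t)) := by
  have hM' : (M : ℝ) ≠ 0 := Nat.cast_ne_zero.2 hM
  have hs := abs_pos.2 ht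
  have h := abs_sin_mul_deriv_dirichlet_le hM ht
  have e : |Real.sin (Real.pi * t)| * (M * (Real.pi * cscBound M t * (1 + cscBound M t)))
      = Real.pi * (1 + cscBound M t) := by
    have : cscBound M t * (M * |Real.sin (Real.pi * t)|) = 1 := by
      rw [cscBound]
      field_simp
    linear_combination Real.pi * (1 + cscBound M t) * this
  rw [← e] at h
  exact le_of_mul_le_mul_left h hs

theorem valueKernel_zero {M : ℕ} (hM : M ≠ 0) : valueKernel M 0 = 1 := by
  simp [valueKernel, dirichlet_zero hM]

theorem slopeKernel_zero (M : ℕ) : slopeKernel M 0 = 0 := by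
  simp [slopeKernel]

theorem hasDerivAt_valueKernel (M : ℕ) (t : ℝ) :
    HasDerivAt (valueKernel M) (4 * dirichlet M t ^ 3 * deriv (dirichlet M) t) t := by
  simpa [valueKernel] using! (differentiable_dirichlet M t).hasDerivAt.pow 4

theorem hasDerivAt_slopeKernel (M : ℕ) (t : ℝ) :
    HasDerivAt (slopeKernel M)
      (M * (4 * dirichlet M t ^ 3 * (Real.sin (Real.pi * t) * deriv (dirichlet M) t)
          * Real.cos (Real.pi * t) / Real.pi
        + dirichlet M t ^ 4 * Real.cos (2 * Real.pi * t))) t := by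
  have hpt : HasDerivAt (fun s : ℝ => 2 * Real.pi * s) (2 * Real.pi) t := by
    simpa using (hasDerivAt_id t).const_mul (2 * Real.pi)
  have h := ((hasDerivAt_valueKernel M t).mul hpt.sin).const_mul (M / (2 * Real.pi))
  refine HasDerivAt.congr_deriv h ?_
  have hpi := Real.pi_ne_zero
  rw [show Real.sin (2 * Real.pi * t)
    = 2 * Real.sin (Real.pi * t) * Real.cos (Real.pi * t) by rw [← Real.sin_two_mul]; ring_nf]
  rw [valueKernel]
  field_simp

theorem abs_valueKernel_le_one (M : ℕ) (t : ℝ) : |valueKernel M t| ≤ 1 := by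
  rw [valueKernel, abs_pow]
  exact pow_le_one₀ (abs_nonneg _) (abs_dirichlet_le_one M t)

/-- One factor `D` of the kernel cancels against `M sin (πt)`. -/
theorem slopeKernel_eq {M : ℕ} (hM : M ≠ 0) (t : ℝ) : slopeKernel M t
    = dirichlet M t ^ 3 * Real.sin (M * (Real.pi * t)) * Real.cos (Real.pi * t) / Real.pi := by
  rw [← mul_sin_mul_dirichlet hM, slopeKernel, show Real.sin (2 * Real.pi * t)
    = 2 * Real.sin (Real.pi * t) * Real.cos (Real.pi * t) by rw [← Real.sin_two_mul]; ring_nf]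
  have hpi := Real.pi_ne_zero
  field_simp

theorem abs_slopeKernel_le_pow {M : ℕ} (hM : M ≠ 0) (t : ℝ) :
    |slopeKernel M t| ≤ |dirichlet M t| ^ 3 / Real.pi := by
  have hpi := Real.pi_pos
  rw [slopeKernel_eq hM, abs_div, abs_mul, abs_mul, abs_pow, abs_of_pos hpi]
  gcongr
  have h1 := Real.abs_sin_le_one (M * (Real.pi * t))
  have h2 := Real.abs_cos_le_one (Real.pi * t)
  calc _ ≤ |dirichlet M t| ^ 3 * 1 * 1 := by gcongr
    _ = _ := by ring

theorem abs_slopeKernel_le_one_div_pi {M : ℕ} (hM : M ≠ 0) (t : ℝ) :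
    |slopeKernel M t| ≤ 1 / Real.pi := by
  have hpi := Real.pi_pos
  refine (abs_slopeKernel_le_pow hM t).trans ?_
  gcongr
  exact pow_le_one₀ (abs_nonneg _) (abs_dirichlet_le_one M t)

theorem abs_valueKernel_le {M : ℕ} (hM : M ≠ 0) {t : ℝ} (ht : Real.sin (Real.pi * t) ≠ 0) :
    |valueKernel M t| ≤ cscBound M t ^ 4 := by
  rw [valueKernel, abs_pow]
  have := abs_dirichlet_le hM ht
  gcongr

theorem abs_slopeKernel_le {M : ℕ} (hM : M ≠ 0) {t : ℝ} (ht : Real.sin (Real.pi * t) ≠ 0) :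
    |slopeKernel M t| ≤ cscBound M t ^ 3 / Real.pi := by
  have hpi := Real.pi_pos
  refine (abs_slopeKernel_le_pow hM t).trans ?_
  have := abs_dirichlet_le hM ht
  gcongr

theorem abs_deriv_valueKernel_le {M : ℕ} (hM : M ≠ 0) {t : ℝ}
    (ht : Real.sin (Real.pi * t) ≠ 0) :
    |deriv (valueKernel M) t|
      ≤ M * (4 * Real.pi * cscBound M t ^ 4 * (1 + cscBound M t)) := by
  have hu := cscBound_nonneg M t
  have hpi := Real.pi_pos
  rw [(hasDerivAt_valueKernel M t).deriv, abs_mul, abs_mul, abs_pow,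
    abs_of_pos (by norm_num : (0 : ℝ) < 4)]
  calc _ ≤ 4 * cscBound M t ^ 3 * (M * (Real.pi * cscBound M t * (1 + cscBound M t))) := by
        gcongr
        · exact abs_dirichlet_le hM ht
        · exact abs_deriv_dirichlet_le hM ht
    _ = _ := by ring

theorem abs_deriv_slopeKernel_le {M : ℕ} (hM : M ≠ 0) {t : ℝ}
    (ht : Real.sin (Real.pi * t) ≠ 0) :
    |deriv (slopeKernel M) t| ≤ M * (4 * cscBound M t ^ 3 + 5 * cscBound M t ^ 4) := by
  have hu := cscBound_nonneg M t
  have hpi := Real.pi_pos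
  have hD := abs_dirichlet_le hM ht
  have hD' := abs_sin_mul_deriv_dirichlet_le hM ht
  have hc := Real.abs_cos_le_one (Real.pi * t)
  have hc2 := Real.abs_cos_le_one (2 * Real.pi * t)
  rw [(hasDerivAt_slopeKernel M t).deriv, abs_mul, Nat.abs_cast]
  gcongr
  refine (abs_add_le _ _).trans ?_
  rw [abs_div, abs_mul, abs_mul, abs_mul, abs_mul, abs_mul, abs_pow, abs_pow, abs_of_pos hpi,
    abs_of_pos (by norm_num : (0 : ℝ) < 4)]
  calc _ ≤ 4 * cscBound M t ^ 3 * (Real.pi * (1 + cscBound M t)) * 1 / Real.pi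
        + cscBound M t ^ 4 * 1 := by gcongr
    _ = _ := by
      field_simp
      ring

/-- The square of the Dirichlet kernel has integer frequencies, because
`cos A cos B = (cos (A - B) + cos (A + B)) / 2`. -/
theorem dirichlet_sq_mem_trigSpan (M : ℕ) :
    (fun t => ((dirichlet M t ^ 2 : ℝ) : ℂ)) ∈ trigSpan (M - 1) := by
  have e : (fun t => ((dirichlet M t ^ 2 : ℝ) : ℂ)) = (1 / (2 * M ^ 2) : ℂ) •
      ∑ j ∈ range M, ∑ k ∈ range M,
        ((fun t : ℝ => ((Real.cos (2 * Real.pi * ((j - k : ℤ) : ℝ) * t) : ℝ) : ℂ))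
        + (fun t : ℝ => ((Real.cos (2 * Real.pi * ((j + k + 1 - M : ℤ) : ℝ) * t) : ℝ) : ℂ))) := by
    ext t
    simp only [Pi.smul_apply, Finset.sum_apply, Pi.add_apply, smul_eq_mul]
    rw [dirichlet, div_pow, sq (∑ k ∈ range M, _), sum_mul_sum]
    push_cast
    rw [mul_sum, sum_div]
    refine sum_congr rfl fun j _ => ?_
    rw [mul_sum, sum_div]
    refine sum_congr rfl fun k _ => ?_
    have e1 : (2 * Real.pi * (j - k) * t : ℂ)
        = Real.pi * (2 * j + 1 - M) * t - Real.pi * (2 * k + 1 - M) * t := by ring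
    have e2 : (2 * Real.pi * (j + k + 1 - M) * t : ℂ)
        = Real.pi * (2 * j + 1 - M) * t + Real.pi * (2 * k + 1 - M) * t := by ring
    rw [e1, e2, Complex.cos_sub, Complex.cos_add]
    ring
  rw [e]
  refine Submodule.smul_mem _ _ (Submodule.sum_mem _ fun j hj => Submodule.sum_mem _ fun k hk => ?_)
  rw [mem_range] at hj hk
  exact Submodule.add_mem _ (cos_mem_trigSpan (abs_le.2 ⟨by omega, by omega⟩))
    (cos_mem_trigSpan (abs_le.2 ⟨by omega, by omega⟩))

theorem valueKernel_mem_trigSpan (M : ℕ) :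
    (fun t => (valueKernel M t : ℂ)) ∈ trigSpan (2 * M - 2) := by
  have h := mul_mem_trigSpan (dirichlet_sq_mem_trigSpan M) (dirichlet_sq_mem_trigSpan M)
  have e : (fun t => (valueKernel M t : ℂ))
      = (fun t => ((dirichlet M t ^ 2 : ℝ) : ℂ)) * fun t => ((dirichlet M t ^ 2 : ℝ) : ℂ) := by
    ext t
    simp only [valueKernel, Pi.mul_apply]
    push_cast
    ring
  rw [e, show (2 * M - 2 : ℤ) = M - 1 + (M - 1) by ring]
  exact h

theorem slopeKernel_mem_trigSpan (M : ℕ) :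
    (fun t => (slopeKernel M t : ℂ)) ∈ trigSpan (2 * M - 1) := by
  have h := Submodule.smul_mem _ (M / (2 * Real.pi) : ℂ)
    (mul_mem_trigSpan (valueKernel_mem_trigSpan M) (sin_mem_trigSpan (N := 1) (k := 1) (by simp)))
  have e : (fun t => (slopeKernel M t : ℂ)) = (M / (2 * Real.pi) : ℂ) •
      ((fun t => (valueKernel M t : ℂ)) *
        fun t : ℝ => ((Real.sin (2 * Real.pi * ((1 : ℤ) : ℝ) * t) : ℝ) : ℂ)) := by
    ext t
    simp only [slopeKernel, valueKernel, Pi.mul_apply, Pi.smul_apply, smul_eq_mul]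
    push_cast
    ring_nf
  rw [e, show (2 * M - 1 : ℤ) = 2 * M - 2 + 1 by ring]
  exact h

/-! ### Sums over separated points -/

theorem one_div_sin_sq_le {x : ℝ} (h0 : 0 < x) (h1 : x ≤ Real.pi / 2) :
    1 / Real.sin x ^ 2 ≤ 1 / x ^ 2 + 1 := by
  have hs : 0 < Real.sin x := Real.sin_pos_of_pos_of_lt_pi h0 (by linarith [Real.pi_pos])
  have hc : 0 ≤ Real.cos x := Real.cos_nonneg_of_mem_Icc ⟨by linarith, h1⟩
  have hxc : x * Real.cos x ≤ Real.sin x := by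
    rcases h1.eq_or_lt with rfl | h
    · simp
    · have h2 := Real.lt_tan h0 h
      have h3 : 0 < Real.cos x := Real.cos_pos_of_mem_Ioo ⟨by linarith, h⟩
      rw [Real.tan_eq_sin_div_cos, lt_div_iff₀ h3] at h2
      exact h2.le
  have h4 : (x * Real.cos x) ^ 2 ≤ Real.sin x ^ 2 := by gcongr
  have h5 := Real.sin_sq_add_cos_sq x
  have e : 1 / x ^ 2 + 1 = (1 + x ^ 2) / x ^ 2 := by field_simp
  rw [e, div_le_div_iff₀ (by positivity) (by positivity)]
  rw [mul_pow] at h4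
  nlinarith [sq_nonneg x]

theorem abs_sin_pi_mul_sub_int (t : ℝ) (m : ℤ) :
    |Real.sin (Real.pi * (t - m))| = |Real.sin (Real.pi * t)| := by
  rw [show Real.pi * (t - m) = Real.pi * t - m * Real.pi by ring, Real.sin_sub_int_mul_pi, abs_mul]
  simp

theorem cscBound_sub_int (M : ℕ) (t : ℝ) (m : ℤ) : cscBound M (t - m) = cscBound M t := by
  rw [cscBound, abs_sin_pi_mul_sub_int, cscBound]

theorem cscBound_sq_le (M : ℕ) {x : ℝ} (hx0 : x ≠ 0) (hx : |x| ≤ 1 / 2) :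
    cscBound M x ^ 2 ≤ 1 / (Real.pi * (M * x)) ^ 2 + 1 / M ^ 2 := by
  have hpi := Real.pi_pos
  have h := one_div_sin_sq_le (x := Real.pi * |x|) (by positivity) (by nlinarith)
  have e : Real.sin (Real.pi * |x|) ^ 2 = Real.sin (Real.pi * x) ^ 2 := by
    rcases abs_choice x with h | h <;> rw [h]
    rw [mul_neg, Real.sin_neg, neg_sq]
  rw [e, mul_pow, sq_abs] at h
  rw [cscBound, div_pow, mul_pow, sq_abs]
  calc (1 : ℝ) ^ 2 / (M ^ 2 * Real.sin (Real.pi * x) ^ 2)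
      = 1 / M ^ 2 * (1 / Real.sin (Real.pi * x) ^ 2) := by rw [one_pow, one_div_mul_one_div]
    _ ≤ 1 / M ^ 2 * (1 / (Real.pi ^ 2 * x ^ 2) + 1) := by gcongr
    _ = _ := by rw [mul_add, one_div_mul_one_div]; ring_nf

/-- The weight `1 / κ ^ 2` of the interval `[k, k + 1)`, where `κ` is its end point closer to `0`;
it is `0`, by division by zero, for the two intervals that have `0` as an end point. -/
noncomputable def cellWeight (k : ℤ) : ℝ := if 0 ≤ k then 1 / (k : ℝ) ^ 2 else 1 / (k + 1 : ℝ) ^ 2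

theorem cellWeight_nonneg (k : ℤ) : 0 ≤ cellWeight k := by
  unfold cellWeight
  split_ifs <;> positivity

theorem hasSum_cellWeight : HasSum cellWeight (Real.pi ^ 2 / 3) := by
  have h1 : HasSum (fun n : ℕ => cellWeight n) (Real.pi ^ 2 / 6) := by
    simpa [cellWeight] using hasSum_zeta_two
  have h2 : HasSum (fun n : ℕ => cellWeight (-(n + 1))) (Real.pi ^ 2 / 6) := by
    convert hasSum_zeta_two using 1
    ext n
    have : ¬ (0 : ℤ) ≤ -(n + 1) := by omega
    rw [cellWeight, if_neg this]
    push_cast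
    ring
  convert h1.of_nat_of_neg_add_one h2 using 1
  ring

/-- The number `k` of the cell `[kδ / M, (k + 1)δ / M)` that contains the representative of `t`
modulo `1` nearest to `0`. -/
noncomputable def cell (M : ℕ) (δ t : ℝ) : ℤ := ⌊M * (t - round t) / δ⌋

/-- The indices `j` for which `t - v j` lies in neither of the two cells next to `0`. -/
noncomputable def farIndices {n : ℕ} (M : ℕ) (δ : ℝ) (v : Fin n → ℝ) (t : ℝ) : Finset (Fin n) :=
  univ.filter fun j => cell M δ (t - v j) ≠ 0 ∧ cell M δ (t - v j) ≠ -1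

theorem mem_farIndices {n M : ℕ} {δ t : ℝ} {v : Fin n → ℝ} {j : Fin n} :
    j ∈ farIndices M δ v t ↔ cell M δ (t - v j) ≠ 0 ∧ cell M δ (t - v j) ≠ -1 := by
  simp [farIndices]

/-- The points `v j` are, modulo `1`, at mutual distance more than `ε`. -/
def SeparatedModOne {n : ℕ} (ε : ℝ) (v : Fin n → ℝ) : Prop :=
  ∀ i j, i ≠ j → ∀ m : ℤ, ε < |v i - v j - m|

section Separated

variable {M n : ℕ} {δ : ℝ} {v : Fin n → ℝ}

/-- A cell is shorter than the separation, so it holds at most one point. -/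
theorem cell_injective (hM : M ≠ 0) (hδ : 0 < δ) (hv : SeparatedModOne (δ / M) v) (t : ℝ) :
    Function.Injective fun j => cell M δ (t - v j) := by
  intro i j hij
  by_contra hne
  have hM' : 0 < (M : ℝ) := Nat.cast_pos.2 (Nat.pos_of_ne_zero hM)
  have h := Int.abs_sub_lt_one_of_floor_eq_floor hij
  have h2 := hv i j hne (round (t - v j) - round (t - v i))
  rw [← sub_div, ← mul_sub, abs_div, abs_mul, abs_of_pos hM', abs_of_pos hδ, div_lt_one hδ] at h
  rw [div_lt_iff₀ hM', abs_sub_comm] at h2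
  push_cast at h2
  have e : (round (t - v j) : ℝ) - round (t - v i) - (v i - v j)
      = t - v i - round (t - v i) - (t - v j - round (t - v j)) := by ring
  rw [e] at h2
  linarith

theorem card_compl_farIndices_le (hM : M ≠ 0) (hδ : 0 < δ) (hv : SeparatedModOne (δ / M) v)
    (t : ℝ) : (farIndices M δ v t)ᶜ.card ≤ 2 := by
  have h : (farIndices M δ v t)ᶜ.card ≤ ({0, -1} : Finset ℤ).card := by
    refine card_le_card_of_injOn (fun j => cell M δ (t - v j)) ?_
      (cell_injective hM hδ hv t).injOn
    intro j hj
    rw [coe_compl, Set.mem_compl_iff, mem_coe, mem_farIndices] at hj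
    simp only [coe_insert, coe_singleton, Set.mem_insert_iff, Set.mem_singleton_iff]
    tauto
  exact h

/-- At a node, the two neighbouring cells contain no other node: this uses that the separation is
strict, because the cell `[-δ / M, 0)` contains its left end point. -/
theorem mem_farIndices_of_ne (hM : M ≠ 0) (hδ : 0 < δ) (hv : SeparatedModOne (δ / M) v)
    {i j : Fin n} (hij : i ≠ j) : j ∈ farIndices M δ v (v i) := by
  have hM' : 0 < (M : ℝ) := Nat.cast_pos.2 (Nat.pos_of_ne_zero hM)
  have h := hv i j hij (round (v i - v j))
  rw [div_lt_iff₀ hM'] at h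
  rw [mem_farIndices]
  unfold cell
  set x := v i - v j - round (v i - v j)
  have h' : δ < |M * x| := by
    rw [abs_mul, abs_of_pos hM']
    linarith
  constructor <;> intro h0 <;> rw [Int.floor_eq_iff] at h0 <;> push_cast at h0 <;>
    rw [le_div_iff₀ hδ, div_lt_iff₀ hδ] at h0 <;> rcases lt_abs.1 h' with h1 | h1 <;> linarith

theorem cellWeight_le_one (k : ℤ) : cellWeight k ≤ 1 := by
  have key : ∀ m : ℤ, 1 / (m : ℝ) ^ 2 ≤ 1 := by
    intro m
    rcases eq_or_ne m 0 with rfl | hm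
    · simp
    · refine div_le_one_of_le₀ ?_ (sq_nonneg _)
      have : (1 : ℤ) ≤ m ^ 2 :=
        (Int.one_le_abs (pow_ne_zero 2 hm)).trans_eq (abs_of_nonneg (sq_nonneg m))
      exact_mod_cast this
  unfold cellWeight
  split_ifs
  · exact key k
  · exact_mod_cast key (k + 1)

/-- Outside the two cells next to `0`, the distance to `0` is at least that of the nearer end point
of the cell, which bounds `1 / (M |sin (πx)|)` in terms of the number of the cell. -/
theorem sin_ne_zero_and_cscBound_sq_le (hM : M ≠ 0) (hδ : 0 < δ) {t : ℝ} {j : Fin n}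
    (hj : j ∈ farIndices M δ v t) :
    Real.sin (Real.pi * (t - v j)) ≠ 0 ∧
      cscBound M (t - v j) ^ 2
        ≤ 1 / (Real.pi * δ) ^ 2 * cellWeight (cell M δ (t - v j)) + 1 / M ^ 2 := by
  have hM' : 0 < (M : ℝ) := Nat.cast_pos.2 (Nat.pos_of_ne_zero hM)
  have hpi := Real.pi_pos
  rw [mem_farIndices] at hj
  set y := t - v j
  set x := y - round y with hxdef
  have hx : |x| ≤ 1 / 2 := abs_sub_round y
  obtain ⟨κ, hκ0, hκ, hw⟩ : ∃ κ : ℝ, 0 < κ ^ 2 ∧ (δ * κ) ^ 2 ≤ (M * x) ^ 2 ∧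
      cellWeight (cell M δ y) = 1 / κ ^ 2 := by
    have hfl := Int.floor_le (M * x / δ)
    have hfl' := Int.lt_floor_add_one (M * x / δ)
    change (cell M δ y : ℝ) ≤ _ at hfl
    change _ < (cell M δ y : ℝ) + 1 at hfl'
    rw [le_div_iff₀ hδ] at hfl
    rw [div_lt_iff₀ hδ] at hfl'
    by_cases hk : 0 ≤ cell M δ y
    · have h1 : (1 : ℝ) ≤ cell M δ y := by exact_mod_cast (by omega : (1 : ℤ) ≤ cell M δ y)
      refine ⟨cell M δ y, by positivity, ?_, by rw [cellWeight, if_pos hk]⟩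
      have : 0 ≤ δ * cell M δ y := by positivity
      exact pow_le_pow_left₀ this (by linarith) 2
    · have h1 : (cell M δ y : ℝ) + 1 ≤ -1 := by exact_mod_cast (by omega : cell M δ y + 1 ≤ -1)
      refine ⟨cell M δ y + 1, by nlinarith, ?_, by rw [cellWeight, if_neg hk]⟩
      rw [← neg_sq (δ * _), ← neg_sq (M * x)]
      have : 0 ≤ -(δ * ((cell M δ y : ℝ) + 1)) := by nlinarith
      exact pow_le_pow_left₀ this (by linarith) 2
  have hδκ : 0 < (δ * κ) ^ 2 := by
    rw [mul_pow]
    positivity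
  have hx0 : x ≠ 0 := by
    intro h0
    rw [h0, mul_zero] at hκ
    linarith [zero_pow (M₀ := ℝ) two_ne_zero]
  constructor
  · rw [← abs_ne_zero, ← abs_sin_pi_mul_sub_int y (round y), abs_ne_zero, ← hxdef]
    obtain ⟨h1, h2⟩ := abs_le.1 hx
    rw [Real.sin_ne_zero_iff]
    intro m hm
    have hxm : x = m := mul_left_cancel₀ hpi.ne' (by linarith)
    rw [hxm] at hx hx0
    have hm0 : |m| < 1 := by
      have : |(m : ℝ)| < 1 := by linarith
      exact_mod_cast this
    exact hx0 (by rw [Int.abs_lt_one_iff.1 hm0, Int.cast_zero])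
  · rw [← cscBound_sub_int M y (round y), ← hxdef, hw]
    refine (cscBound_sq_le M hx0 hx).trans ?_
    rw [one_div_mul_one_div, ← mul_pow, mul_assoc, mul_pow, mul_pow Real.pi]
    gcongr

theorem sum_cscBound_sq_le (hM : M ≠ 0) (hδ : 0 < δ) (hv : SeparatedModOne (δ / M) v) (t : ℝ) :
    ∑ j ∈ farIndices M δ v t, cscBound M (t - v j) ^ 2 ≤ 1 / (3 * δ ^ 2) + n / M ^ 2 := by
  have hpi := Real.pi_pos
  have hcells : ∑ j ∈ farIndices M δ v t, cellWeight (cell M δ (t - v j)) ≤ Real.pi ^ 2 / 3 := by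
    rw [← sum_image (f := cellWeight) (g := fun j => cell M δ (t - v j))
      (cell_injective hM hδ hv t).injOn]
    exact sum_le_hasSum _ (fun k _ => cellWeight_nonneg k) hasSum_cellWeight
  have hcard : ((farIndices M δ v t).card : ℝ) ≤ n := by
    exact_mod_cast (card_le_univ _).trans_eq (Fintype.card_fin n)
  calc _ ≤ ∑ j ∈ farIndices M δ v t,
        (1 / (Real.pi * δ) ^ 2 * cellWeight (cell M δ (t - v j)) + 1 / M ^ 2) :=
        sum_le_sum fun j hj => (sin_ne_zero_and_cscBound_sq_le hM hδ hj).2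
    _ = 1 / (Real.pi * δ) ^ 2 * ∑ j ∈ farIndices M δ v t, cellWeight (cell M δ (t - v j))
        + (farIndices M δ v t).card * (1 / M ^ 2) := by
        rw [sum_add_distrib, mul_sum, sum_const, nsmul_eq_mul]
    _ ≤ 1 / (Real.pi * δ) ^ 2 * (Real.pi ^ 2 / 3) + n * (1 / M ^ 2) := by gcongr
    _ = _ := by
        field_simp

/-- The `n` points lie in different intervals `[kδ / M, (k + 1)δ / M)` with `0 ≤ k ≤ M / δ`. -/
theorem card_le_of_separated (hM : M ≠ 0) (hδ : 0 < δ) (hv : SeparatedModOne (δ / M) v)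
    (hv01 : ∀ j, v j ∈ Set.Ico (0 : ℝ) 1) : (n : ℝ) ≤ M / δ + 1 := by
  have hM' : 0 < (M : ℝ) := Nat.cast_pos.2 (Nat.pos_of_ne_zero hM)
  have h : (univ : Finset (Fin n)).card ≤ (range (⌊(M : ℝ) / δ⌋₊ + 1)).card := by
    refine card_le_card_of_injOn (fun j => ⌊M * v j / δ⌋₊) ?_ ?_
    · intro j _
      simp only [coe_range, Set.mem_Iio, Nat.lt_add_one_iff]
      refine Nat.floor_le_floor ?_
      gcongr
      have := (hv01 j).2
      nlinarith
    · intro i _ j _ hij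
      by_contra hne
      have h1 := hv i j hne 0
      have hnn : ∀ j, 0 ≤ M * v j / δ := fun j => by
        have := (hv01 j).1
        positivity
      simp only at hij
      have hi := Nat.floor_le (hnn i)
      have hi' := Nat.lt_floor_add_one (M * v i / δ)
      have hj := Nat.floor_le (hnn j)
      have hj' := Nat.lt_floor_add_one (M * v j / δ)
      rw [hij] at hi hi'
      have h2 : |M * v i / δ - M * v j / δ| < 1 := abs_lt.2 ⟨by linarith, by linarith⟩
      rw [← sub_div, ← mul_sub, abs_div, abs_mul, abs_of_pos hM', abs_of_pos hδ,
        div_lt_one hδ] at h2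
      rw [Int.cast_zero, sub_zero, div_lt_iff₀ hM'] at h1
      linarith
  rw [card_univ, Fintype.card_fin, card_range] at h
  have h3 := Nat.floor_le (by positivity : 0 ≤ (M : ℝ) / δ)
  have h4 : (n : ℝ) ≤ (⌊(M : ℝ) / δ⌋₊ : ℝ) + 1 := by exact_mod_cast h
  linarith

theorem farIndices_self (hM : M ≠ 0) (hδ : 0 < δ) (hv : SeparatedModOne (δ / M) v) (i : Fin n) :
    farIndices M δ v (v i) = univ.erase i := by
  ext j
  rw [mem_erase, and_iff_left (mem_univ j)]
  refine ⟨?_, fun h => mem_farIndices_of_ne hM hδ hv h.symm⟩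
  rintro hj rfl
  rw [mem_farIndices] at hj
  simp [cell] at hj

end Separated

/-- If two points were at distance at most `ε` modulo `1`, then both would lie in the arc of length
`ε` that starts at one of them. -/
theorem RayleighRegular.separatedModOne {n : ℕ} {ε : ℝ} {v : Fin n → ℝ}
    (hv : Function.Injective v) (hv01 : ∀ j, v j ∈ Set.Ico (0 : ℝ) 1)
    (h : RayleighRegular ε 1 (Set.range fun j => (v j : UnitAddCircle))) :
    SeparatedModOne ε v := by
  obtain ⟨P, hP, -, hcard⟩ := h
  have hmem : ∀ j, (v j : UnitAddCircle) ∈ P 0 := by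
    intro j
    have hj : (v j : UnitAddCircle) ∈ ⋃ i, P i := hP ▸ ⟨j, rfl⟩
    obtain ⟨i, hi⟩ := Set.mem_iUnion.1 hj
    rwa [Subsingleton.elim i 0] at hi
  have hne : ∀ i j, i ≠ j → (v i : UnitAddCircle) ≠ v j := by
    intro i j hij heq
    have h0 : ∀ j, v j ∈ Set.Ico (0 : ℝ) (0 + 1) := by simpa using hv01
    exact hij (hv ((AddCircle.coe_eq_coe_iff_of_mem_Ico (h0 i) (h0 j)).1 heq))
  intro i j hij m
  by_contra! hle
  obtain ⟨h1, h2⟩ := abs_le.1 hle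
  have hε : 0 ≤ ε := (abs_nonneg _).trans hle
  have hm : ((v j + m : ℝ) : UnitAddCircle) = v j := by
    rw [AddCircle.coe_add, add_eq_left, AddCircle.coe_eq_zero_iff]
    exact ⟨m, by simp⟩
  have harc : ∀ a : ℝ, v i ∈ Set.Icc a (a + ε) → v j + m ∈ Set.Icc a (a + ε) → False := by
    intro a hi hj
    refine hne i j hij (Set.encard_le_one_iff.1 (hcard 0 a) _ _ ⟨hmem i, v i, hi, rfl⟩
      ⟨hmem j, v j + m, hj, hm⟩)
  rcases le_total (v i) (v j + m) with h3 | h3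
  · exact harc (v i) ⟨le_rfl, by linarith⟩ ⟨h3, by linarith⟩
  · exact harc (v j + m) ⟨h3, by linarith⟩ ⟨le_rfl, by linarith⟩

/-! ### Diagonally dominant systems -/

/-- Two coupled linear systems, each a perturbation of the identity. -/
noncomputable def coupledSystem {n : ℕ} (A B C E : Fin n → Fin n → ℝ) :
    (Fin n → ℝ) × (Fin n → ℝ) →ₗ[ℝ] (Fin n → ℝ) × (Fin n → ℝ) where
  toFun x := (fun i => x.1 i + ∑ j ∈ univ.erase i, (x.1 j * A i j + x.2 j * B i j),
    fun i => x.2 i + ∑ j ∈ univ.erase i, (x.1 j * C i j + x.2 j * E i j))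
  map_add' x y := by
    ext i <;> simp only [Prod.fst_add, Prod.snd_add, Pi.add_apply, add_mul, sum_add_distrib] <;>
      ring
  map_smul' r x := by
    ext i <;> simp only [Prod.smul_fst, Prod.smul_snd, Pi.smul_apply, smul_eq_mul, mul_assoc,
      ← mul_add, ← mul_sum, RingHom.id_apply]

/-- The triangle inequality for one block row of a system with coefficient vectors `α` and `β`; the
diagonal unknown `γ` is whichever of the two has coefficient `1` in that row. -/
theorem norm_le_of_perturbation {n : ℕ} {A B : Fin n → Fin n → ℝ} {p r : ℝ}
    (hA : ∀ i, ∑ j ∈ univ.erase i, |A i j| ≤ p) (hB : ∀ i, ∑ j ∈ univ.erase i, |B i j| ≤ r)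
    (hp : 0 ≤ p) (hr : 0 ≤ r) (α β γ : Fin n → ℝ) {F : ℝ} (hF0 : 0 ≤ F)
    (hF : ∀ i, |γ i + ∑ j ∈ univ.erase i, (α j * A i j + β j * B i j)| ≤ F) :
    ‖γ‖ ≤ F + p * ‖α‖ + r * ‖β‖ := by
  rw [pi_norm_le_iff_of_nonneg (by positivity)]
  intro i
  have hα : ∀ j, |α j| ≤ ‖α‖ := fun j => norm_le_pi_norm α j
  have hβ : ∀ j, |β j| ≤ ‖β‖ := fun j => norm_le_pi_norm β j
  have hsum : |∑ j ∈ univ.erase i, (α j * A i j + β j * B i j)| ≤ p * ‖α‖ + r * ‖β‖ := by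
    calc _ ≤ ∑ j ∈ univ.erase i, (‖α‖ * |A i j| + ‖β‖ * |B i j|) := by
          refine (abs_sum_le_sum_abs _ _).trans (sum_le_sum fun j _ => ?_)
          refine (abs_add_le _ _).trans ?_
          rw [abs_mul, abs_mul]
          have h1 := hα j
          have h2 := hβ j
          gcongr
      _ = (∑ j ∈ univ.erase i, |A i j|) * ‖α‖ + (∑ j ∈ univ.erase i, |B i j|) * ‖β‖ := by
          rw [sum_add_distrib, ← mul_sum, ← mul_sum]
          ring
      _ ≤ _ := by
          have h1 := hA i
          have h2 := hB i
          gcongr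
  have h := abs_sub (γ i + ∑ j ∈ univ.erase i, (α j * A i j + β j * B i j))
    (∑ j ∈ univ.erase i, (α j * A i j + β j * B i j))
  rw [add_sub_cancel_right] at h
  rw [Real.norm_eq_abs]
  linarith [hF i]

/-- A coupled system whose blocks have row sums `p`, `r`, `s`, `u` with
`r * s < (1 - p) * (1 - u)` is solvable, and the solution obeys the two scalar inequalities that
come from the triangle inequality. -/
theorem exists_solution_coupledSystem {n : ℕ} {A B C E : Fin n → Fin n → ℝ} {p r s u : ℝ}
    (hA : ∀ i, ∑ j ∈ univ.erase i, |A i j| ≤ p) (hB : ∀ i, ∑ j ∈ univ.erase i, |B i j| ≤ r)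
    (hC : ∀ i, ∑ j ∈ univ.erase i, |C i j| ≤ s) (hE : ∀ i, ∑ j ∈ univ.erase i, |E i j| ≤ u)
    (hp : 0 ≤ p) (hr : 0 ≤ r) (hs : 0 ≤ s) (hu : 0 ≤ u) (hp1 : p < 1)
    (hdet : r * s < (1 - p) * (1 - u)) {F G : ℝ} (hF0 : 0 ≤ F) (hG0 : 0 ≤ G) (f g : Fin n → ℝ)
    (hf : ∀ i, |f i| ≤ F) (hg : ∀ i, |g i| ≤ G) :
    ∃ α β : Fin n → ℝ,
      (∀ i, α i + ∑ j ∈ univ.erase i, (α j * A i j + β j * B i j) = f i) ∧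
      (∀ i, β i + ∑ j ∈ univ.erase i, (α j * C i j + β j * E i j) = g i) ∧
      ‖α‖ ≤ F + p * ‖α‖ + r * ‖β‖ ∧ ‖β‖ ≤ G + s * ‖α‖ + u * ‖β‖ := by
  have hinj : Function.Injective (coupledSystem A B C E) := by
    rw [injective_iff_map_eq_zero]
    rintro ⟨α, β⟩ h
    have h1 : ∀ i, α i + ∑ j ∈ univ.erase i, (α j * A i j + β j * B i j) = 0 :=
      congrFun (congrArg Prod.fst h)
    have h2 : ∀ i, β i + ∑ j ∈ univ.erase i, (α j * C i j + β j * E i j) = 0 :=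
      congrFun (congrArg Prod.snd h)
    have h3 := norm_le_of_perturbation hA hB hp hr α β α le_rfl fun i => by rw [h1 i, abs_zero]
    have h4 := norm_le_of_perturbation hC hE hs hu α β β le_rfl fun i => by rw [h2 i, abs_zero]
    have hα := norm_nonneg α
    have hβ := norm_nonneg β
    have h5 : (1 - p) * ((1 - u) * ‖β‖) ≤ r * s * ‖β‖ := by
      calc _ ≤ (1 - p) * (s * ‖α‖) := by
            refine mul_le_mul_of_nonneg_left ?_ (by linarith)
            linarith
        _ = s * ((1 - p) * ‖α‖) := by ring
        _ ≤ s * (r * ‖β‖) := by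
            refine mul_le_mul_of_nonneg_left ?_ hs
            linarith
        _ = _ := by ring
    have hβ0 : ‖β‖ = 0 := by
      by_contra hne
      have : 0 < ‖β‖ := lt_of_le_of_ne hβ (Ne.symm hne)
      nlinarith
    have hα0 : ‖α‖ = 0 := by
      by_contra hne
      have : 0 < ‖α‖ := lt_of_le_of_ne hα (Ne.symm hne)
      rw [hβ0] at h3
      nlinarith
    rw [norm_eq_zero] at hα0 hβ0
    rw [hα0, hβ0, Prod.mk_zero_zero]
  obtain ⟨⟨α, β⟩, h⟩ := (LinearMap.injective_iff_surjective.1 hinj) (f, g)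
  have h1 : ∀ i, α i + ∑ j ∈ univ.erase i, (α j * A i j + β j * B i j) = f i :=
    congrFun (congrArg Prod.fst h)
  have h2 : ∀ i, β i + ∑ j ∈ univ.erase i, (α j * C i j + β j * E i j) = g i :=
    congrFun (congrArg Prod.snd h)
  exact ⟨α, β, h1, h2,
    norm_le_of_perturbation hA hB hp hr α β α hF0 fun i => by rw [h1 i]; exact hf i,
    norm_le_of_perturbation hC hE hs hu α β β hG0 fun i => by rw [h2 i]; exact hg i⟩

/-! ### Numerical bounds for the kernels -/

section Numerical

variable {M n : ℕ} {v : Fin n → ℝ}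

/-- The first summand `1 / (3 * 0.927 ^ 2)` of the general bound is below `0.388`, and `n / M ^ 2`
is below `0.018`. -/
theorem sum_cscBound_sq_le_numeric (hM : 64 ≤ M) (hv : SeparatedModOne (0.927 / M) v)
    (hv01 : ∀ j, v j ∈ Set.Ico (0 : ℝ) 1) (t : ℝ) :
    ∑ j ∈ farIndices M 0.927 v t, cscBound M (t - v j) ^ 2 ≤ 0.406 := by
  have hM64 : (64 : ℝ) ≤ M := by exact_mod_cast hM
  have h := sum_cscBound_sq_le (by omega) (by norm_num) hv t
  have hn := card_le_of_separated (by omega) (by norm_num) hv hv01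
  have hn' : (n : ℝ) / M ^ 2 ≤ 0.018 := by
    rw [div_le_iff₀ (by positivity)]
    refine hn.trans ?_
    have : (M : ℝ) / 0.927 ≤ M * 1.08 := by
      rw [div_le_iff₀ (by norm_num)]
      linarith
    nlinarith
  refine h.trans ?_
  norm_num at hn' ⊢
  linarith

/-- The square is below `1 / (0.927 * π) ^ 2 + 1 / 64 ^ 2`, as every cell weight is at most `1`. -/
theorem cscBound_le_numeric (hM : 64 ≤ M) {t : ℝ} {j : Fin n} (hj : j ∈ farIndices M 0.927 v t) :
    cscBound M (t - v j) ≤ 0.3438 := by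
  have hM64 : (64 : ℝ) ≤ M := by exact_mod_cast hM
  have h := (sin_ne_zero_and_cscBound_sq_le (by omega) (by norm_num) hj).2
  have hpi := Real.pi_gt_d4
  have h1 : 1 / (Real.pi * 0.927) ^ 2 * cellWeight (cell M 0.927 (t - v j)) ≤ 0.11792 := by
    calc _ ≤ 1 / (Real.pi * 0.927) ^ 2 * 1 := by
          gcongr
          exact cellWeight_le_one _
      _ ≤ 1 / (3.1415 * 0.927) ^ 2 * 1 := by gcongr
      _ ≤ _ := by norm_num
  have h2 : 1 / (M : ℝ) ^ 2 ≤ 1 / 64 ^ 2 := by gcongr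
  refine le_of_sq_le_sq ?_ (by norm_num)
  refine h.trans ((add_le_add h1 h2).trans (by norm_num))

theorem sum_far_le (hM : 64 ≤ M) (hv : SeparatedModOne (0.927 / M) v)
    (hv01 : ∀ j, v j ∈ Set.Ico (0 : ℝ) 1) (t : ℝ) {φ : Fin n → ℝ} {c : ℝ} (hc : 0 ≤ c)
    (h : ∀ j ∈ farIndices M 0.927 v t, φ j ≤ c * cscBound M (t - v j) ^ 2) :
    ∑ j ∈ farIndices M 0.927 v t, φ j ≤ c * 0.406 := by
  refine (sum_le_sum h).trans ?_
  rw [← mul_sum]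
  have := sum_cscBound_sq_le_numeric hM hv hv01 t
  gcongr

theorem sum_valueKernel_le (hM : 64 ≤ M) (hv : SeparatedModOne (0.927 / M) v)
    (hv01 : ∀ j, v j ∈ Set.Ico (0 : ℝ) 1) (t : ℝ) :
    ∑ j ∈ farIndices M 0.927 v t, |valueKernel M (t - v j)| ≤ 0.048 := by
  refine (sum_far_le hM hv hv01 t (c := 0.1182) (by norm_num) fun j hj => ?_).trans (by norm_num)
  have hu := cscBound_le_numeric hM hj
  have hu0 := cscBound_nonneg M (t - v j)
  refine (abs_valueKernel_le (by omega)
    (sin_ne_zero_and_cscBound_sq_le (by omega) (by norm_num) hj).1).trans ?_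
  set u := cscBound M (t - v j)
  calc u ^ 4 = u ^ 2 * u ^ 2 := by ring
    _ ≤ 0.3438 ^ 2 * u ^ 2 := by gcongr
    _ ≤ _ := by gcongr; norm_num

theorem sum_slopeKernel_le (hM : 64 ≤ M) (hv : SeparatedModOne (0.927 / M) v)
    (hv01 : ∀ j, v j ∈ Set.Ico (0 : ℝ) 1) (t : ℝ) :
    ∑ j ∈ farIndices M 0.927 v t, |slopeKernel M (t - v j)| ≤ 0.0445 := by
  refine (sum_far_le hM hv hv01 t (c := 0.1095) (by norm_num) fun j hj => ?_).trans (by norm_num)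
  have hu := cscBound_le_numeric hM hj
  have hu0 := cscBound_nonneg M (t - v j)
  have hpi := Real.pi_gt_d4
  refine (abs_slopeKernel_le (by omega)
    (sin_ne_zero_and_cscBound_sq_le (by omega) (by norm_num) hj).1).trans ?_
  set u := cscBound M (t - v j)
  calc u ^ 3 / Real.pi = u / Real.pi * u ^ 2 := by ring
    _ ≤ 0.3438 / 3.1415 * u ^ 2 := by gcongr
    _ ≤ _ := by gcongr; norm_num

theorem sum_deriv_valueKernel_le (hM : 64 ≤ M) (hv : SeparatedModOne (0.927 / M) v)
    (hv01 : ∀ j, v j ∈ Set.Ico (0 : ℝ) 1) (t : ℝ) :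
    ∑ j ∈ farIndices M 0.927 v t, |deriv (valueKernel M) (t - v j) / M| ≤ 0.811 := by
  refine (sum_far_le hM hv hv01 t (c := 1.997) (by norm_num) fun j hj => ?_).trans (by norm_num)
  have hM0 : (0 : ℝ) < M := Nat.cast_pos.2 (by omega)
  have hu := cscBound_le_numeric hM hj
  have hu0 := cscBound_nonneg M (t - v j)
  have hpi := Real.pi_lt_d4
  have hpi0 := Real.pi_pos
  rw [abs_div, Nat.abs_cast, div_le_iff₀ hM0, mul_comm _ (M : ℝ)]
  refine (abs_deriv_valueKernel_le (by omega)
    (sin_ne_zero_and_cscBound_sq_le (by omega) (by norm_num) hj).1).trans ?_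
  set u := cscBound M (t - v j)
  refine mul_le_mul_of_nonneg_left ?_ hM0.le
  calc 4 * Real.pi * u ^ 4 * (1 + u) = 4 * Real.pi * u ^ 2 * (1 + u) * u ^ 2 := by ring
    _ ≤ 4 * 3.1416 * 0.3438 ^ 2 * (1 + 0.3438) * u ^ 2 := by gcongr
    _ ≤ _ := by gcongr; norm_num

theorem sum_deriv_slopeKernel_le (hM : 64 ≤ M) (hv : SeparatedModOne (0.927 / M) v)
    (hv01 : ∀ j, v j ∈ Set.Ico (0 : ℝ) 1) (t : ℝ) :
    ∑ j ∈ farIndices M 0.927 v t, |deriv (slopeKernel M) (t - v j) / M| ≤ 0.799 := by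
  refine (sum_far_le hM hv hv01 t (c := 1.967) (by norm_num) fun j hj => ?_).trans (by norm_num)
  have hM0 : (0 : ℝ) < M := Nat.cast_pos.2 (by omega)
  have hu := cscBound_le_numeric hM hj
  have hu0 := cscBound_nonneg M (t - v j)
  rw [abs_div, Nat.abs_cast, div_le_iff₀ hM0, mul_comm _ (M : ℝ)]
  refine (abs_deriv_slopeKernel_le (by omega)
    (sin_ne_zero_and_cscBound_sq_le (by omega) (by norm_num) hj).1).trans ?_
  set u := cscBound M (t - v j)
  refine mul_le_mul_of_nonneg_left ?_ hM0.le
  calc 4 * u ^ 3 + 5 * u ^ 4 = (4 * u + 5 * u ^ 2) * u ^ 2 := by ring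
    _ ≤ (4 * 0.3438 + 5 * 0.3438 ^ 2) * u ^ 2 := by gcongr
    _ ≤ _ := by gcongr; norm_num

end Numerical

/-! ### The interpolating polynomial -/

/-- The combination of translated kernels with coefficients `α` and `β`. -/
noncomputable def kernelCombination {n : ℕ} (M : ℕ) (v α β : Fin n → ℝ) (t : ℝ) : ℝ :=
  ∑ j, (α j * valueKernel M (t - v j) + β j * slopeKernel M (t - v j))

theorem hasDerivAt_kernelCombination {n : ℕ} (M : ℕ) (v α β : Fin n → ℝ) (t : ℝ) :
    HasDerivAt (kernelCombination M v α β)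
      (∑ j, (α j * deriv (valueKernel M) (t - v j) + β j * deriv (slopeKernel M) (t - v j))) t := by
  refine HasDerivAt.fun_sum fun j _ => ?_
  have h1 := (hasDerivAt_valueKernel M (t - v j)).differentiableAt.hasDerivAt.comp_sub_const t (v j)
  have h2 := (hasDerivAt_slopeKernel M (t - v j)).differentiableAt.hasDerivAt.comp_sub_const t (v j)
  exact (h1.const_mul (α j)).add (h2.const_mul (β j))

theorem isTrigPoly_kernelCombination {n : ℕ} {M : ℕ} {fc : ℝ} (hfc : (2 * M - 1 : ℤ) ≤ ⌊fc⌋)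
    (v α β : Fin n → ℝ) : IsTrigPoly fc (kernelCombination M v α β) := by
  apply isTrigPoly_of_mem_trigSpan
  have e : (fun t => (kernelCombination M v α β t : ℂ)) =
      ∑ j, ((α j : ℂ) • (fun t => (valueKernel M (t - v j) : ℂ))
        + (β j : ℂ) • (fun t => (slopeKernel M (t - v j) : ℂ))) := by
    ext t
    simp only [kernelCombination, Finset.sum_apply, Pi.add_apply, Pi.smul_apply, smul_eq_mul]
    push_cast
    rfl
  rw [e]
  refine Submodule.sum_mem _ fun j _ => Submodule.add_mem _ ?_ ?_
  · exact Submodule.smul_mem _ _ (trigSpan_mono (by omega)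
      (comp_sub_mem_trigSpan (valueKernel_mem_trigSpan M) (v j)))
  · exact Submodule.smul_mem _ _ (trigSpan_mono hfc
      (comp_sub_mem_trigSpan (slopeKernel_mem_trigSpan M) (v j)))

/-- The two cells next to `t` hold at most two points, for which `|K| ≤ 1` and `|H| ≤ 1 / π`; the
other points contribute the row sums. -/
theorem abs_kernelCombination_le {n M : ℕ} {v : Fin n → ℝ} (hM : 64 ≤ M)
    (hv : SeparatedModOne (0.927 / M) v) (hv01 : ∀ j, v j ∈ Set.Ico (0 : ℝ) 1)
    (α β : Fin n → ℝ) (t : ℝ) :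
    |kernelCombination M v α β t| ≤ 2.048 * ‖α‖ + 0.6813 * ‖β‖ := by
  have hM0 : M ≠ 0 := by omega
  have hα : ∀ j, |α j| ≤ ‖α‖ := fun j => norm_le_pi_norm α j
  have hβ : ∀ j, |β j| ≤ ‖β‖ := fun j => norm_le_pi_norm β j
  have hterm : ∀ j, |α j * valueKernel M (t - v j) + β j * slopeKernel M (t - v j)|
      ≤ ‖α‖ * |valueKernel M (t - v j)| + ‖β‖ * |slopeKernel M (t - v j)| := by
    intro j
    refine (abs_add_le _ _).trans ?_
    rw [abs_mul, abs_mul]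
    have h1 := hα j
    have h2 := hβ j
    gcongr
  have hpi : 1 / Real.pi ≤ 0.3184 := by
    rw [div_le_iff₀ Real.pi_pos]
    linarith [Real.pi_gt_d4]
  have hfar : ∑ j ∈ farIndices M 0.927 v t,
      (‖α‖ * |valueKernel M (t - v j)| + ‖β‖ * |slopeKernel M (t - v j)|)
      ≤ ‖α‖ * 0.048 + ‖β‖ * 0.0445 := by
    rw [sum_add_distrib, ← mul_sum, ← mul_sum]
    have h1 := sum_valueKernel_le hM hv hv01 t
    have h2 := sum_slopeKernel_le hM hv hv01 t
    gcongr
  have hnear : ∑ j ∈ (farIndices M 0.927 v t)ᶜ,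
      (‖α‖ * |valueKernel M (t - v j)| + ‖β‖ * |slopeKernel M (t - v j)|)
      ≤ 2 * (‖α‖ * 1 + ‖β‖ * 0.3184) := by
    have hcard : ((farIndices M 0.927 v t)ᶜ.card : ℝ) ≤ 2 := by
      exact_mod_cast card_compl_farIndices_le hM0 (by norm_num) hv t
    calc _ ≤ ∑ j ∈ (farIndices M 0.927 v t)ᶜ, (‖α‖ * 1 + ‖β‖ * 0.3184) := by
          refine sum_le_sum fun j _ => ?_
          have h1 := abs_valueKernel_le_one M (t - v j)
          have h2 := (abs_slopeKernel_le_one_div_pi hM0 (t - v j)).trans hpi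
          gcongr
      _ = (farIndices M 0.927 v t)ᶜ.card * (‖α‖ * 1 + ‖β‖ * 0.3184) := by
          rw [sum_const, nsmul_eq_mul]
      _ ≤ _ := by gcongr
  refine (abs_sum_le_sum_abs _ _).trans ((sum_le_sum fun j _ => hterm j).trans ?_)
  rw [← sum_add_sum_compl (farIndices M 0.927 v t)]
  linarith

theorem exists_kernelCombination {n M : ℕ} {v : Fin n → ℝ} (hM : 64 ≤ M)
    (hv : SeparatedModOne (0.927 / M) v) (hv01 : ∀ j, v j ∈ Set.Ico (0 : ℝ) 1)
    (f d : Fin n → ℝ) (hf : ∀ j, |f j| ≤ 1) (hd : ∀ j, |d j| ≤ 2.016 * M) :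
    ∃ α β : Fin n → ℝ,
      (∀ i, kernelCombination M v α β (v i) = f i ∧ deriv (kernelCombination M v α β) (v i) = d i) ∧
      ∀ t, |kernelCombination M v α β t| ≤ cU0 := by
  have hM0 : M ≠ 0 := by omega
  have hMpos : (0 : ℝ) < M := Nat.cast_pos.2 (by omega)
  have herase := farIndices_self hM0 (by norm_num) hv
  have hg : ∀ j, |d j / M| ≤ 2.016 := by
    intro j
    rw [abs_div, Nat.abs_cast, div_le_iff₀ hMpos]
    exact hd j
  -- The derivative conditions are divided by `M`, the slope of `slopeKernel M` at `0`.
  obtain ⟨α, β, h1, h2, h3, h4⟩ := exists_solution_coupledSystem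
    (A := fun i j => valueKernel M (v i - v j)) (B := fun i j => slopeKernel M (v i - v j))
    (C := fun i j => deriv (valueKernel M) (v i - v j) / M)
    (E := fun i j => deriv (slopeKernel M) (v i - v j) / M)
    (fun i => herase i ▸ sum_valueKernel_le hM hv hv01 (v i))
    (fun i => herase i ▸ sum_slopeKernel_le hM hv hv01 (v i))
    (fun i => herase i ▸ sum_deriv_valueKernel_le hM hv hv01 (v i))
    (fun i => herase i ▸ sum_deriv_slopeKernel_le hM hv hv01 (v i))
    (by norm_num) (by norm_num) (by norm_num) (by norm_num) (by norm_num)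
    (by norm_num) (by norm_num) (by norm_num) f (fun j => d j / M) hf hg
  refine ⟨α, β, fun i => ⟨?_, ?_⟩, fun t => ?_⟩
  · rw [kernelCombination, ← add_sum_erase _ _ (mem_univ i), sub_self, valueKernel_zero hM0,
      slopeKernel_zero, ← h1 i]
    ring
  · have hv0 : deriv (valueKernel M) 0 = 0 := by
      rw [(hasDerivAt_valueKernel M 0).deriv, deriv_dirichlet_zero, mul_zero]
    have hs0 : deriv (slopeKernel M) 0 = M := by
      rw [(hasDerivAt_slopeKernel M 0).deriv, deriv_dirichlet_zero, dirichlet_zero hM0]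
      simp
    rw [(hasDerivAt_kernelCombination M v α β (v i)).deriv, ← add_sum_erase _ _ (mem_univ i),
      sub_self, hv0, hs0]
    have e : d i = M * (d i / M) := by field_simp
    rw [e, ← h2 i, mul_add, mul_sum]
    congr 1
    · ring
    · refine sum_congr rfl fun j _ => ?_
      field_simp
  · have h5 : ‖α‖ ≤ 1.9 := by linarith
    have h6 : ‖β‖ ≤ 17.7 := by linarith
    refine (abs_kernelCombination_le hM hv hv01 α β t).trans ?_
    rw [cU0, cAlpha, cBeta]
    linarith

theorem mainTheorem4 (lam : ℝ) (hlam0 : 0 < lam) (hlam1 : lam < 1 / 128)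
    (n : ℕ) (v : Fin n → ℝ) (hv : StrictMono v) (hv01 : ∀ j, v j ∈ Set.Ico (0 : ℝ) 1)
    (hsep : RayleighRegular (1.87 * lam) 1 (Set.range fun j => (v j : UnitAddCircle)))
    (f d : Fin n → ℝ) (hf : ∀ j, |f j| ≤ 1) (hd : ∀ j, |d j| ≤ 1 / lam) :
    ∃ q : ℝ → ℝ,
      IsTrigPoly (1 / lam) q ∧
      (∀ j, q (v j) = f j ∧ deriv q (v j) = d j) ∧
      (∀ t, |q t| ≤ cU0) ∧
      (∀ t, |deriv q t| ≤ cU1 / lam) ∧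
      (∀ t, |iteratedDeriv 2 q t| ≤ cU2 / lam ^ 2) := by
  have hfc : 0 < 1 / lam := by positivity
  -- `M` is the largest integer for which the degree `2M - 1` of the kernels is at most `1 / lam`.
  set N := ⌊1 / lam⌋₊ with hN
  set M := (N + 1) / 2 with hMdef
  have hN128 : 128 ≤ N := by
    rw [hN, Nat.le_floor_iff hfc.le, le_div_iff₀ hlam0]
    push_cast
    linarith
  have hM : 64 ≤ M := by omega
  have hMpos : (0 : ℝ) < M := Nat.cast_pos.2 (by omega)
  have hdeg : (2 * M - 1 : ℤ) ≤ ⌊1 / lam⌋ := by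
    have h : (2 * M - 1 : ℤ) ≤ N := by omega
    refine h.trans (Int.le_floor.2 ?_)
    exact_mod_cast Nat.floor_le hfc.le
  -- `M * lam > (1 - lam) / 2`, as `2M` exceeds `1 / lam - 1`.
  have hMlam : 127 / 256 < M * lam := by
    have h1 := Nat.lt_floor_add_one (1 / lam)
    rw [← hN, div_lt_iff₀ hlam0] at h1
    have h2 : (N : ℝ) ≤ 2 * M := by exact_mod_cast (by omega : N ≤ 2 * M)
    nlinarith
  -- `0.927 < 1.87 * 127 / 256`.
  have hsep' : SeparatedModOne (0.927 / M) v := by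
    intro i j hij m
    refine lt_of_le_of_lt ?_ (hsep.separatedModOne hv.injective hv01 i j hij m)
    rw [div_le_iff₀ hMpos]
    linarith
  -- `256 / 127 < 2.016`.
  have hd' : ∀ j, |d j| ≤ 2.016 * M := by
    intro j
    refine (hd j).trans ?_
    rw [div_le_iff₀ hlam0]
    linarith
  obtain ⟨α, β, hint, hbound⟩ := exists_kernelCombination hM hsep' hv01 f d hf hd'
  have hq := isTrigPoly_kernelCombination hdeg v α β
  have h1 := hq.abs_deriv_le hfc hbound
  have h2 := hq.deriv.abs_deriv_le hfc h1
  refine ⟨_, hq, hint, hbound, fun t => (h1 t).trans_eq ?_, fun t => ?_⟩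
  · rw [cU1]
    ring
  · rw [iteratedDeriv_succ, iteratedDeriv_one]
    refine (h2 t).trans_eq ?_
    rw [cU2]
    field_simp
    ring
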